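/- Let $q:\mathbb{R}\to\mathbb{C}$ be $1$-periodic and Lebesgue integrable on $[0,1]$, with Fourier coefficients $q_n=\int_0^1 q(x)e^{-2\pi i n x}\,dx$, $n\in\mathbb{Z}$. Assume that $q_n=0$ for all $n\le 0$, or that $q_n=0$ for all $n\ge 0$. For $t\in\mathbb{C}$ let $L_t(q)$ be the operator $y\mapsto -y''+qy$ in $L_2[0,1]$ whose domain consists of all $y$ such that $y,y'$ are absolutely continuous on $[0,1]$, $-y''+qy\in L_2[0,1]$, and $$y(1)=e^{it}y(0),\qquad y'(1)=e^{it}y'(0).$$ An eigenvalue $\lambda$ is called simple (double) if its algebraic multiplicity, that is, the dimension of the root space $\bigcup_{k\ge1}\ker (L_t(q)-\lambda)^k$, equals $1$ (equals $2$). Then: 1. for every $t\in\mathbb{C}$, the set of eigenvalues of $L_t(q)$ is exactly $\{(2\pi n+t)^2 : n\in\mathbb{Z}\}$; 2. if $t\ne\pi k$ for all $k\in\mathbb{Z}$, then $(2\pi n+t)^2$ is a simple eigenvalue of $L_t(q)$ for every $n\in\mathbb{Z}$; 3. $(2\pi n)^2$ is a double eigenvalue of $L_0(q)$ for every $n\in\mathbb{Z}\setminus\{0\}$;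 4. $(2\pi n+\pi)^2$ is a double eigenvalue of $L_\pi(q)$ for every $n\in\mathbb{Z}$. -/

import Mathlib

open MeasureTheory Set Filter

/-- The complex Hilbert space `L₂[0,1]`. -/
abbrev L2I : Type := Lp ℂ 2 (volume.restrict (Icc (0 : ℝ) 1))

/-- `y` is continuously differentiable on `[0,1]` with derivative `y'`, the function `y'` is
absolutely continuous on `[0,1]` with `y'' = q y - g` almost everywhere, that is `-y'' + q y = g`
(absolute continuity is expressed by `y'` being an indefinite Lebesgue integral), and
`y(1) = e^{it} y(0)`, `y'(1) = e^{it} y'(0)`. -/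
structure IsHillSolution (q : ℝ → ℂ) (t : ℂ) (g y y' : ℝ → ℂ) : Prop where
  hasDeriv : ∀ x ∈ Icc (0 : ℝ) 1, HasDerivWithinAt y (y' x) (Icc 0 1) x
  integrable : IntervalIntegrable (fun s => q s * y s - g s) volume 0 1
  deriv_eq : ∀ x ∈ Icc (0 : ℝ) 1, y' x = y' 0 + ∫ s in (0 : ℝ)..x, (q s * y s - g s)
  bc : y 1 = Complex.exp (Complex.I * t) * y 0
  bc' : y' 1 = Complex.exp (Complex.I * t) * y' 0

theorem IsHillSolution.congr {q : ℝ → ℂ} {t : ℂ} {g g₂ y y' : ℝ → ℂ}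
    (h : IsHillSolution q t g y y') (hg : g =ᵐ[volume.restrict (Icc (0 : ℝ) 1)] g₂) :
    IsHillSolution q t g₂ y y' := by
  have hae : ∀ᵐ s, s ∈ Icc (0 : ℝ) 1 → q s * y s - g s = q s * y s - g₂ s := by
    have := (ae_restrict_iff' measurableSet_Icc).1 hg
    filter_upwards [this] with s hs hm
    rw [hs hm]
  refine ⟨h.hasDeriv, ?_, ?_, h.bc, h.bc'⟩
  · refine h.integrable.congr_ae ?_
    rw [EventuallyEq, ae_restrict_iff' measurableSet_uIoc]
    filter_upwards [hae] with s hs hm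
    rw [uIoc_of_le zero_le_one] at hm
    exact hs (Ioc_subset_Icc_self hm)
  · intro x hx
    rw [h.deriv_eq x hx]
    congr 1
    refine intervalIntegral.integral_congr_ae ?_
    filter_upwards [hae] with s hs hm
    rw [uIoc_of_le hx.1] at hm
    exact hs ⟨hm.1.le, hm.2.trans hx.2⟩

theorem IsHillSolution.add {q : ℝ → ℂ} {t : ℂ} {g₁ g₂ y₁ y₂ y₁' y₂' : ℝ → ℂ}
    (h₁ : IsHillSolution q t g₁ y₁ y₁') (h₂ : IsHillSolution q t g₂ y₂ y₂') :
    IsHillSolution q t (g₁ + g₂) (y₁ + y₂) (y₁' + y₂') := by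
  have e : (fun s => q s * (y₁ + y₂) s - (g₁ + g₂) s) =
      fun s => (q s * y₁ s - g₁ s) + (q s * y₂ s - g₂ s) := by
    funext s; simp only [Pi.add_apply]; ring
  refine ⟨fun x hx => (h₁.hasDeriv x hx).add (h₂.hasDeriv x hx), ?_, ?_, ?_, ?_⟩
  · rw [e]; exact h₁.integrable.add h₂.integrable
  · intro x hx
    have hs : uIcc (0 : ℝ) x ⊆ uIcc 0 1 := by
      rw [uIcc_of_le hx.1, uIcc_of_le zero_le_one]; exact Icc_subset_Icc_right hx.2
    rw [e, intervalIntegral.integral_add (h₁.integrable.mono_set hs) (h₂.integrable.mono_set hs)]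
    simp only [Pi.add_apply]
    rw [h₁.deriv_eq x hx, h₂.deriv_eq x hx]; ring
  · simp only [Pi.add_apply, h₁.bc, h₂.bc]; ring
  · simp only [Pi.add_apply, h₁.bc', h₂.bc']; ring

theorem IsHillSolution.smul {q : ℝ → ℂ} {t : ℂ} {g y y' : ℝ → ℂ}
    (h : IsHillSolution q t g y y') (c : ℂ) :
    IsHillSolution q t (c • g) (c • y) (c • y') := by
  have e : (fun s => q s * (c • y) s - (c • g) s) = fun s => c * (q s * y s - g s) := by
    funext s; simp only [Pi.smul_apply, smul_eq_mul]; ring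
  refine ⟨fun x hx => (h.hasDeriv x hx).const_smul c, ?_, ?_, ?_, ?_⟩
  · rw [e]; exact h.integrable.const_mul c
  · intro x hx
    rw [e, intervalIntegral.integral_const_mul]
    simp only [Pi.smul_apply, smul_eq_mul]
    rw [h.deriv_eq x hx]; ring
  · simp only [Pi.smul_apply, smul_eq_mul, h.bc]; ring
  · simp only [Pi.smul_apply, smul_eq_mul, h.bc']; ring

theorem IsHillSolution.zero (q : ℝ → ℂ) (t : ℂ) : IsHillSolution q t 0 0 0 := by
  refine ⟨fun x _ => hasDerivWithinAt_const x _ (0 : ℂ), ?_, ?_, ?_, ?_⟩ <;> simp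

/-- The graph of the operator `L_t(q)`: the pairs `(f, g)` of elements of `L₂[0,1]` such that `f`
has a representative `y` with `y, y'` absolutely continuous on `[0,1]` which satisfies the
quasi-periodic boundary conditions and `-y'' + q y = g`. -/
def hillGraph (q : ℝ → ℂ) (t : ℂ) : Submodule ℂ (L2I × L2I) where
  carrier := {p | ∃ y y' : ℝ → ℂ,
    (p.1 : ℝ → ℂ) =ᵐ[volume.restrict (Icc (0 : ℝ) 1)] y ∧ IsHillSolution q t p.2 y y'}
  zero_mem' := ⟨0, 0, Lp.coeFn_zero _ _ _, (IsHillSolution.zero q t).congr (Lp.coeFn_zero _ _ _).symm⟩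
  add_mem' := by
    rintro ⟨f₁, g₁⟩ ⟨f₂, g₂⟩ ⟨y₁, y₁', hf₁, h₁⟩ ⟨y₂, y₂', hf₂, h₂⟩
    exact ⟨y₁ + y₂, y₁' + y₂', (Lp.coeFn_add f₁ f₂).trans (hf₁.add hf₂),
      (h₁.add h₂).congr (Lp.coeFn_add g₁ g₂).symm⟩
  smul_mem' := by
    rintro c ⟨f, g⟩ ⟨y, y', hf, h⟩
    exact ⟨c • y, c • y', (Lp.coeFn_smul c f).trans (hf.const_smul c),
      (h.smul c).congr (Lp.coeFn_smul c g).symm⟩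

/-- The operator `L_t(q)` in `L₂[0,1]` generated by `-y'' + q y` and the boundary conditions
`y(1) = e^{it} y(0)`, `y'(1) = e^{it} y'(0)`, on its natural (maximal) domain. -/
noncomputable def hillOperator (q : ℝ → ℂ) (t : ℂ) : L2I →ₗ.[ℂ] L2I :=
  (hillGraph q t).toLinearPMap

/-- `hillGraph` is single-valued. -/
theorem hillGraph_snd_eq_zero (q : ℝ → ℂ) (t : ℂ) (p : L2I × L2I) (hp : p ∈ hillGraph q t)
    (h0 : p.1 = 0) : p.2 = 0 := by
  obtain ⟨f, g⟩ := p
  obtain ⟨y, y', hf, h⟩ := hp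
  simp only at hf h h0 ⊢
  subst h0
  have hy0 : y =ᵐ[volume.restrict (Icc (0 : ℝ) 1)] (fun _ => (0 : ℂ)) :=
    hf.symm.trans (Lp.coeFn_zero _ _ _)
  have hyc : ContinuousOn y (Icc 0 1) := fun x hx => (h.hasDeriv x hx).continuousWithinAt
  have hy : EqOn y (fun _ => (0 : ℂ)) (Icc 0 1) :=
    Measure.eqOn_Icc_of_ae_eq volume zero_ne_one hy0 hyc continuousOn_const
  have hy' : ∀ x ∈ Icc (0 : ℝ) 1, y' x = 0 := fun x hx =>
    (uniqueDiffOn_Icc zero_lt_one x hx).eq_deriv _ (h.hasDeriv x hx)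
      ((hasDerivWithinAt_const x _ (0 : ℂ)).congr (fun z hz => hy hz) (hy hx))
  have hint : ∀ x ∈ Icc (0 : ℝ) 1, ∫ s in (0 : ℝ)..x, (q s * y s - (g : ℝ → ℂ) s) = 0 := by
    intro x hx
    have := h.deriv_eq x hx
    rw [hy' x hx, hy' 0 (left_mem_Icc.2 zero_le_one), zero_add] at this
    exact this.symm
  have hLeb := h.integrable.ae_hasDerivAt_integral
  have h₀ : ∀ᵐ x : ℝ, x ≠ 0 := by simp [ae_iff, measure_singleton]
  have h₁ : ∀ᵐ x : ℝ, x ≠ 1 := by simp [ae_iff, measure_singleton]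
  have hg0 : (g : ℝ → ℂ) =ᵐ[volume.restrict (Icc (0 : ℝ) 1)] 0 := by
    rw [EventuallyEq, ae_restrict_iff' measurableSet_Icc]
    filter_upwards [hLeb, h₀, h₁] with x hx hx0 hx1 hm
    rw [uIcc_of_le zero_le_one] at hx
    have hd := (hx hm 0 (left_mem_Icc.2 zero_le_one)).hasDerivWithinAt (s := Icc 0 1)
    have hd0 := (hasDerivWithinAt_const x (Icc (0 : ℝ) 1) (0 : ℂ)).congr hint (hint x hm)
    have := (uniqueDiffOn_Icc zero_lt_one x hm).eq_deriv _ hd hd0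
    rw [hy hm, mul_zero, zero_sub, neg_eq_zero] at this
    simpa using this
  exact (Lp.eq_zero_iff_ae_eq_zero).2 hg0

theorem hillOperator_graph (q : ℝ → ℂ) (t : ℂ) : (hillOperator q t).graph = hillGraph q t :=
  Submodule.toLinearPMap_graph_eq _ (hillGraph_snd_eq_zero q t)

section Operator

variable {E : Type*} [AddCommGroup E] [Module ℂ E]

/-- `z` is an eigenvalue of the (not everywhere defined) linear operator `A`. -/
def IsEigenvalue (A : E →ₗ.[ℂ] E) (z : ℂ) : Prop :=
  ∃ f : A.domain, (f : E) ≠ 0 ∧ A f = z • (f : E)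

/-- `rootSpace A z k` is the kernel of `(A - z)^k`, with the natural domain of that power. -/
def rootSpace (A : E →ₗ.[ℂ] E) (z : ℂ) : ℕ → Submodule ℂ E
  | 0 => ⊥
  | k + 1 =>
    { carrier := {f | ∃ h : f ∈ A.domain, A ⟨f, h⟩ - z • f ∈ rootSpace A z k}
      zero_mem' := by
        refine ⟨A.domain.zero_mem, ?_⟩
        have e : A ⟨0, A.domain.zero_mem⟩ = 0 := A.map_zero
        rw [e, smul_zero, sub_zero]
        exact (rootSpace A z k).zero_mem
      add_mem' := by
        rintro f g ⟨hf, hf'⟩ ⟨hg, hg'⟩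
        refine ⟨A.domain.add_mem hf hg, ?_⟩
        have e : A ⟨f + g, A.domain.add_mem hf hg⟩ = A ⟨f, hf⟩ + A ⟨g, hg⟩ :=
          A.map_add ⟨f, hf⟩ ⟨g, hg⟩
        rw [e, smul_add, add_sub_add_comm]
        exact (rootSpace A z k).add_mem hf' hg'
      smul_mem' := by
        rintro c f ⟨hf, hf'⟩
        refine ⟨A.domain.smul_mem c hf, ?_⟩
        have e : A ⟨c • f, A.domain.smul_mem c hf⟩ = c • A ⟨f, hf⟩ := A.map_smul c ⟨f, hf⟩
        rw [e, smul_comm z c f, ← smul_sub]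
        exact (rootSpace A z k).smul_mem c hf' }

/-- The algebraic multiplicity of `z`: the dimension of the space of all root functions
(eigenvectors and associated vectors) of `A` at `z`. -/
noncomputable def algMultiplicity (A : E →ₗ.[ℂ] E) (z : ℂ) : Cardinal :=
  Module.rank ℂ (⨆ k : ℕ, rootSpace A z k : Submodule ℂ E)

/-- A simple eigenvalue: one of algebraic multiplicity `1`. -/
def IsSimpleEigenvalue (A : E →ₗ.[ℂ] E) (z : ℂ) : Prop :=
  IsEigenvalue A z ∧ algMultiplicity A z = 1

/-- A double eigenvalue: one of algebraic multiplicity `2`. -/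
def IsDoubleEigenvalue (A : E →ₗ.[ℂ] E) (z : ℂ) : Prop :=
  IsEigenvalue A z ∧ algMultiplicity A z = 2

end Operator

/-!
# The spectrum of Hill operators with one-sided complex potentials

In the basis `e^{i(2πn+t)x}` the operator `L_t(q) - z` is the infinite matrix with diagonal entries
`d n = (2πn+t)² - z` and off-diagonal part the Toeplitz matrix of the Fourier coefficients of `q`.
When `q` has only positive frequencies this matrix is strictly lower triangular off the diagonal;
when it has only negative frequencies, it becomes so after the change of index `n ↦ -n`, carried by
a sign `σ` below. So the spectral data are those of the diagonal, provided that the infinite system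
can be solved from `-∞` upwards.

* Passing between the operator and the matrix. Functions in the domain have summable coefficients
  (two integrations by parts, and `∑ 1/n² < ∞`), so that multiplication by the integrable function
  `q` is an honest convolution. Conversely, a summable solution of the matrix equations is made into
  a solution of the boundary value problem by taking quasi-periodic primitives twice
  (`exists_primitive`). Together with Fourier uniqueness this describes each `ker (L_t(q) - z)^k`
  by sequences (`mem_rootSpace_iff`).
* Uniqueness. Near `-∞` the diagonal dominates, which makes the triangular system a contraction
  in `ℓ¹`; above that, the entries are determined one after the other. Hence a root sequence is
  determined by its entries at the zeros of `d` (`IsRootSequence.eq_zero_of_le`), and the algebraic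
  multiplicity is at most the number of these zeros.
* Existence. The triangular recursion can be started at any index, and a Grönwall estimate with
  `∑ 1/|d n| < ∞` shows that the result is summable (`exists_triangular_solution`). Started at the
  last zero of `d` it gives an eigenfunction. If `d` has two zeros, the one started at the
  first gives a further root function (`exists_root_sequence`), associated with a multiple of that
  eigenfunction.

It remains to count the `n` with `(2πn+t)² = (2πm+t)²`: these are `n = m` and, if `t` is an integer
multiple of `π`, also the solution of `2πn + t = -(2πm + t)`.
-/

/-! ### Quasi-periodic Fourier series -/

/-- The `n`-th coefficient of `f` with respect to the system `e^{i(2πn+t)x}` on `[0,1]`. The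
quasi-momentum `t` is complex, so the dual system is `e^{-i(2πn+t)x}` (no conjugation of `t`). -/
noncomputable def coeff (t : ℂ) (f : ℝ → ℂ) (n : ℤ) : ℂ :=
  ∫ x in (0 : ℝ)..1, Complex.exp (-(Complex.I * (2 * Real.pi * n + t) * x)) * f x

/-- The function `∑ aₙ e^{i(2πn+t)x}`. The factor `e^{itx}` is kept outside the series, so that the
terms of the series are bounded on the whole line. -/
noncomputable def synth (t : ℂ) (a : ℤ → ℂ) (x : ℝ) : ℂ :=
  Complex.exp (Complex.I * t * x) * ∑' n : ℤ, a n * Complex.exp (2 * Real.pi * Complex.I * n * x)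

theorem norm_exp_two_pi_int (n : ℤ) (x : ℝ) :
    ‖Complex.exp (2 * Real.pi * Complex.I * n * x)‖ = 1 := by
  have : (2 * Real.pi * Complex.I * n * x : ℂ) = ((2 * Real.pi * n * x : ℝ) : ℂ) * Complex.I := by
    push_cast; ring
  rw [this, Complex.norm_exp_ofReal_mul_I]

theorem summable_synth_term {a : ℤ → ℂ} (ha : Summable a) (x : ℝ) :
    Summable fun n : ℤ => a n * Complex.exp (2 * Real.pi * Complex.I * n * x) := by
  refine Summable.of_norm_bounded ha.norm fun n => ?_
  rw [norm_mul, norm_exp_two_pi_int, mul_one]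

theorem continuous_synth (t : ℂ) {a : ℤ → ℂ} (ha : Summable a) : Continuous (synth t a) := by
  unfold synth
  refine Continuous.mul (by fun_prop) ?_
  refine continuous_tsum (fun n => by fun_prop) ha.norm fun n x => ?_
  rw [norm_mul, norm_exp_two_pi_int, mul_one]

theorem synth_one (t : ℂ) (a : ℤ → ℂ) :
    synth t a 1 = Complex.exp (Complex.I * t) * synth t a 0 := by
  have h : ∀ n : ℤ, Complex.exp (2 * Real.pi * Complex.I * n * (1 : ℝ)) = 1 := fun n => by
    rw [Complex.exp_eq_one_iff]; exact ⟨n, by push_cast; ring⟩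
  simp only [synth, h]
  simp

theorem coeff_zero_const_one (n : ℤ) : coeff 0 (fun _ => 1) n = if n = 0 then 1 else 0 := by
  unfold coeff
  split_ifs with h
  · simp [h]
  · have hc : (-(Complex.I * (2 * Real.pi * n)) : ℂ) ≠ 0 := by
      simp [h, Real.pi_ne_zero]
    have e : ∀ x : ℝ, Complex.exp (-(Complex.I * (2 * Real.pi * n + 0) * x)) * 1 =
        Complex.exp (-(Complex.I * (2 * Real.pi * n)) * x) := fun x => by
      rw [mul_one]; congr 1; ring
    simp only [e]
    rw [integral_exp_mul_complex hc]
    have : Complex.exp (-(Complex.I * (2 * Real.pi * n)) * (1 : ℝ)) = 1 := by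
      rw [Complex.exp_eq_one_iff]; exact ⟨-n, by push_cast; ring⟩
    rw [this]; simp

/-- Multiplication by an integrable function acts on coefficients as a convolution. -/
theorem hasSum_coeff_mul_synth {q : ℝ → ℂ} (hq : IntervalIntegrable q volume 0 1) (t : ℂ)
    {a : ℤ → ℂ} (ha : Summable a) (n : ℤ) :
    HasSum (fun m => a m * coeff 0 q (n - m)) (coeff t (fun x => q x * synth t a x) n) := by
  have hm : AEStronglyMeasurable q (volume.restrict (uIoc 0 1)) :=
    (intervalIntegrable_iff.1 hq).aestronglyMeasurable
  have key : ∀ m : ℤ, a m * coeff 0 q (n - m) = ∫ x in (0 : ℝ)..1,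
      a m * (Complex.exp (2 * Real.pi * Complex.I * ((m - n : ℤ) : ℂ) * x) * q x) := fun m => by
    rw [coeff, ← intervalIntegral.integral_const_mul]
    congr 1; ext x; congr 3; push_cast; ring
  simp only [key]
  unfold coeff
  refine intervalIntegral.hasSum_integral_of_dominated_convergence
    (fun m x => ‖a m‖ * ‖q x‖) (fun m => ?_) (fun m => ?_) ?_ ?_ ?_
  · refine AEStronglyMeasurable.const_mul ?_ _
    exact AEStronglyMeasurable.mul (Continuous.aestronglyMeasurable (by fun_prop)) hm
  · filter_upwards with x _
    rw [norm_mul, norm_mul, norm_exp_two_pi_int, one_mul]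
  · filter_upwards with x _
    exact ha.norm.mul_right _
  · simp only [tsum_mul_right]
    exact hq.norm.const_mul _
  · filter_upwards with x _
    have h := (summable_synth_term ha x).hasSum.mul_left
      (Complex.exp (-(Complex.I * (2 * Real.pi * n) * x)) * q x)
    have e1 : ∀ m : ℤ, Complex.exp (-(Complex.I * (2 * Real.pi * n) * x)) * q x *
        (a m * Complex.exp (2 * Real.pi * Complex.I * m * x)) =
        a m * (Complex.exp (2 * Real.pi * Complex.I * ((m - n : ℤ) : ℂ) * x) * q x) := fun m => by
      have : (2 * Real.pi * Complex.I * ((m - n : ℤ) : ℂ) * x : ℂ) =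
        -(Complex.I * (2 * Real.pi * n) * x) + 2 * Real.pi * Complex.I * m * x := by
        push_cast; ring
      rw [this, Complex.exp_add]; ring
    have e2 : Complex.exp (-(Complex.I * (2 * Real.pi * n) * x)) * q x *
        ∑' m : ℤ, a m * Complex.exp (2 * Real.pi * Complex.I * m * x) =
        Complex.exp (-(Complex.I * (2 * Real.pi * n + t) * x)) * (q x * synth t a x) := by
      have : (-(Complex.I * (2 * Real.pi * n + t) * x) : ℂ) =
        -(Complex.I * (2 * Real.pi * n) * x) + -(Complex.I * t * x) := by ring
      rw [synth, this, Complex.exp_add, Complex.exp_neg (Complex.I * t * x)]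
      have := Complex.exp_ne_zero (Complex.I * t * x)
      field_simp
    simpa only [e1, e2] using h

theorem coeff_synth (t : ℂ) {a : ℤ → ℂ} (ha : Summable a) (n : ℤ) : coeff t (synth t a) n = a n := by
  have h := hasSum_coeff_mul_synth (q := fun _ => 1) intervalIntegrable_const t ha n
  simp only [one_mul, coeff_zero_const_one] at h
  refine h.unique ?_
  have := hasSum_ite_eq n (a n)
  convert this using 2 with m
  by_cases hmn : m = n
  · simp [hmn]
  · have : n - m ≠ 0 := sub_ne_zero.2 (Ne.symm hmn)
    simp [hmn, this]

theorem fourierCoeffOn_eq_coeff (q : ℝ → ℂ) (n : ℤ) :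
    fourierCoeffOn (zero_lt_one' ℝ) q n = coeff 0 q n := by
  rw [fourierCoeffOn_eq_integral, coeff]
  simp only [sub_zero, div_one, one_smul, smul_eq_mul]
  congr 1; ext x; rw [fourier_coe_apply]; congr 2; push_cast; ring

/-- A continuous quasi-periodic function with summable coefficients is the sum of its series. -/
theorem eqOn_synth_coeff {t : ℂ} {y : ℝ → ℂ} (hy : ContinuousOn y (Icc 0 1))
    (hbc : y 1 = Complex.exp (Complex.I * t) * y 0) (hs : Summable (coeff t y)) :
    EqOn y (synth t (coeff t y)) (Icc 0 1) := by
  have : Fact ((0 : ℝ) < 1) := ⟨zero_lt_one⟩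
  set F : ℝ → ℂ := fun x => Complex.exp (-(Complex.I * t * x)) * y x with hF
  have hFc : ContinuousOn F (Icc 0 1) := ContinuousOn.mul (by fun_prop) hy
  have hF01 : F 0 = F 1 := by
    simp only [hF, hbc, ← mul_assoc, ← Complex.exp_add]; simp
  have hc : Continuous (AddCircle.liftIco 1 0 F) :=
    AddCircle.liftIco_zero_continuous hF01 hFc
  let G : C(AddCircle (1 : ℝ), ℂ) := ⟨AddCircle.liftIco 1 0 F, hc⟩
  have hGc : ∀ n, fourierCoeff G n = coeff t y n := fun n => by
    have h := fourierCoeff_liftIco_eq (T := (1 : ℝ)) (a := 0) F n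
    change fourierCoeff (AddCircle.liftIco 1 0 F) n = _
    rw [h, fourierCoeffOn_eq_integral, coeff]
    simp only [zero_add, sub_zero, div_one, one_smul, smul_eq_mul]
    congr 1; ext x
    simp only [hF]
    rw [fourier_coe_apply, ← mul_assoc, ← Complex.exp_add]; congr 2; push_cast; ring
  have hIco : EqOn y (synth t (coeff t y)) (Ico 0 1) := by
    intro x hx
    have h := has_pointwise_sum_fourier_series_of_summable (f := G)
      (by simpa only [funext hGc] using hs) (x : AddCircle (1 : ℝ))
    have hGx : G (x : AddCircle (1 : ℝ)) = F x := by
      change AddCircle.liftIco 1 0 F (x : AddCircle (1 : ℝ)) = F x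
      exact AddCircle.liftIco_coe_apply (by rwa [zero_add])
    rw [hGx] at h
    have h2 := h.mul_left (Complex.exp (Complex.I * t * x))
    have e : Complex.exp (Complex.I * t * x) * F x = y x := by
      simp only [hF, ← mul_assoc, ← Complex.exp_add]; simp
    rw [e] at h2
    rw [synth, ← h2.tsum_eq, ← tsum_mul_left]
    congr 1; ext n
    rw [hGc, smul_eq_mul, fourier_coe_apply]; congr 4; push_cast; ring
  intro x hx
  rcases hx.2.lt_or_eq with h | rfl
  · exact hIco ⟨hx.1, h⟩
  · rw [hbc, synth_one, hIco ⟨le_rfl, zero_lt_one⟩]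

/-! ### Integration by parts and quasi-periodic primitives -/

/-- The complex form of `IntervalIntegrable.absolutelyContinuousOnInterval_intervalIntegral`, by
splitting into real and imaginary parts. -/
theorem absolutelyContinuousOnInterval_integral {w : ℝ → ℂ}
    (hw : IntervalIntegrable w volume 0 1) :
    AbsolutelyContinuousOnInterval (fun x => ∫ s in (0 : ℝ)..x, w s) 0 1 := by
  have hr : IntervalIntegrable (fun s => (w s).re) volume 0 1 :=
    ⟨hw.1.re, hw.2.re⟩
  have hi : IntervalIntegrable (fun s => (w s).im) volume 0 1 :=
    ⟨hw.1.im, hw.2.im⟩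
  have hconst : ∀ c : ℂ, AbsolutelyContinuousOnInterval (fun _ : ℝ => c) 0 1 := fun c =>
    ContDiffOn.absolutelyContinuousOnInterval contDiffOn_const
  have h := ((hr.absolutelyContinuousOnInterval_intervalIntegral (c := 0) (by simp)).smul
    (hconst 1)).add ((hi.absolutelyContinuousOnInterval_intervalIntegral (c := 0) (by simp)).smul
    (hconst Complex.I))
  unfold AbsolutelyContinuousOnInterval at h ⊢
  refine h.congr' ?_
  rw [EventuallyEq, eventually_inf_principal]
  filter_upwards with p hp
  refine Finset.sum_congr rfl fun i hi' => ?_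
  have e : ∀ x ∈ uIcc (0 : ℝ) 1, (∫ s in (0 : ℝ)..x, w s) =
      (∫ s in (0 : ℝ)..x, (w s).re) • (1 : ℂ) + (∫ s in (0 : ℝ)..x, (w s).im) • Complex.I := by
    intro x hx
    have hs : uIcc (0 : ℝ) x ⊆ uIcc 0 1 := uIcc_subset_uIcc_left hx
    have h1 := intervalIntegral.intervalIntegral_re (hw.mono_set hs)
    have h2 := intervalIntegral.intervalIntegral_im (hw.mono_set hs)
    simp only [RCLike.re_to_complex, RCLike.im_to_complex] at h1 h2
    rw [h1, h2, Complex.real_smul, Complex.real_smul, mul_one, Complex.re_add_im]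
  simp only [Pi.add_apply, Pi.smul_apply']
  rw [e _ (hp.1 i hi').1, e _ (hp.1 i hi').2]

/-- The coefficients of an indefinite integral: integration by parts against `e^{-i(2πn+t)x}`, the
boundary terms cancelling by quasi-periodicity. -/
theorem coeff_of_primitive {t : ℂ} {v w : ℝ → ℂ} (hw : IntervalIntegrable w volume 0 1)
    (hv : ∀ x ∈ Icc (0 : ℝ) 1, v x = v 0 + ∫ s in (0 : ℝ)..x, w s)
    (hbc : v 1 = Complex.exp (Complex.I * t) * v 0) (n : ℤ) :
    coeff t w n = Complex.I * (2 * Real.pi * n + t) * coeff t v n := by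
  set c : ℂ := Complex.I * (2 * Real.pi * n + t) with hc
  set φ : ℝ → ℂ := fun x => Complex.exp (-(c * x)) with hφ
  set V : ℝ → ℂ := fun x => v 0 + ∫ s in (0 : ℝ)..x, w s with hV
  have hφd : ∀ x : ℝ, HasDerivAt φ (-c * φ x) x := fun x => by
    have h : HasDerivAt (fun x : ℝ => -(c * (x : ℂ))) (-(c * 1)) x :=
      ((Complex.ofRealCLM.hasDerivAt (x := x)).const_mul c).neg
    convert! h.cexp using 1
    simp [hφ]; ring
  have hφc : Continuous φ := by fun_prop
  have hVac : AbsolutelyContinuousOnInterval V 0 1 :=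
    (ContDiffOn.absolutelyContinuousOnInterval contDiffOn_const).add
      (absolutelyContinuousOnInterval_integral hw)
  have hφac : AbsolutelyContinuousOnInterval φ 0 1 := by
    refine ContDiffOn.absolutelyContinuousOnInterval (ContDiff.contDiffOn ?_)
    have : ContDiff ℝ 1 (fun x : ℝ => -(c * (x : ℂ))) :=
      (contDiff_const.mul Complex.ofRealCLM.contDiff).neg
    exact this.cexp
  have hVc : ContinuousOn V (uIcc 0 1) := hVac.continuousOn
  have i1 : IntervalIntegrable (fun x => φ x * V x) volume 0 1 :=
    (hφc.continuousOn.mul hVc).intervalIntegrable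
  have i2 : IntervalIntegrable (fun x => φ x * w x) volume 0 1 :=
    hw.continuousOn_mul hφc.continuousOn
  have i3 : IntervalIntegrable (fun x => -c * (φ x * V x) + φ x * w x) volume 0 1 :=
    (i1.const_mul _).add i2
  -- `φ V - ∫ (φ' V + φ w)` is absolutely continuous with derivative zero almost everywhere
  have hG := ((hφac.smul hVac).sub
    (absolutelyContinuousOnInterval_integral i3)).const_of_ae_hasDerivAt_zero (by
      filter_upwards [hw.ae_hasDerivAt_integral, i3.ae_hasDerivAt_integral] with x h1 h2 hx
      have h1' := (h1 hx 0 (by simp)).const_add (v 0)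
      have := ((hφd x).mul h1').sub (h2 hx 0 (by simp))
      convert! this using 1
      simp only [hV]; ring)
  obtain ⟨C, hC⟩ := hG
  have h0 := hC 0 (by simp)
  have h1 := hC 1 (by simp)
  have hV0 : V 0 = v 0 := by simp [hV]
  have hV1 : V 1 = v 1 := (hv 1 (by simp)).symm
  have hexp : φ 1 * Complex.exp (Complex.I * t) = 1 := by
    simp only [hφ, hc, ← Complex.exp_add]
    rw [Complex.exp_eq_one_iff]; exact ⟨-n, by push_cast; ring⟩
  have hφ0 : φ 0 = 1 := by simp [hφ]
  simp only [Pi.sub_apply, smul_eq_mul, Pi.mul_apply, hV0, hV1, hφ0,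
    one_mul,
    intervalIntegral.integral_same, hbc] at h0 h1
  rw [intervalIntegral.integral_add (i1.const_mul _) i2,
    intervalIntegral.integral_const_mul, ← mul_assoc, hexp, one_mul] at h1
  have e1 : ∫ x in (0 : ℝ)..1, φ x * V x = coeff t v n := by
    refine intervalIntegral.integral_congr fun x hx => ?_
    rw [uIcc_of_le zero_le_one] at hx
    simp only [hV, hφ, hc, ← hv x hx]
  have e2 : ∫ x in (0 : ℝ)..1, φ x * w x = coeff t w n := rfl
  rw [e1, e2] at h1
  linear_combination h0 - h1

theorem exp_I_mul_eq_one_iff (t : ℂ) :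
    Complex.exp (Complex.I * t) = 1 ↔ ∃ n : ℤ, 2 * (Real.pi : ℂ) * n + t = 0 := by
  rw [Complex.exp_eq_one_iff]
  constructor
  · rintro ⟨n, hn⟩
    refine ⟨-n, ?_⟩
    have : t = n * (2 * Real.pi) := mul_left_cancel₀ Complex.I_ne_zero (by rw [hn]; ring)
    rw [this]; push_cast; ring
  · rintro ⟨n, hn⟩
    refine ⟨-n, ?_⟩
    rw [eq_neg_of_add_eq_zero_right hn]; push_cast; ring

theorem continuousOn_primitive {w : ℝ → ℂ} (hw : IntervalIntegrable w volume 0 1) (c : ℂ) :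
    ContinuousOn (fun x => c + ∫ s in (0 : ℝ)..x, w s) (Icc 0 1) := by
  have := (absolutelyContinuousOnInterval_integral hw).continuousOn
  rw [uIcc_of_le zero_le_one] at this
  exact continuousOn_const.add this

/-- An integrable function whose coefficients are formally those of a derivative has a
quasi-periodic primitive with the prescribed coefficients. When `e^{it} ≠ 1`, quasi-periodicity
determines the constant of integration; when `e^{it} = 1`, it holds for every constant, which is
then fixed by the one coefficient with `2πn + t = 0`. -/
theorem exists_primitive {t : ℂ} {w : ℝ → ℂ} {c : ℤ → ℂ} (hw : IntervalIntegrable w volume 0 1)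
    (hc : ∀ n, coeff t w n = Complex.I * (2 * Real.pi * n + t) * c n) :
    ∃ v : ℝ → ℂ, (∀ x ∈ Icc (0 : ℝ) 1, v x = v 0 + ∫ s in (0 : ℝ)..x, w s) ∧
      v 1 = Complex.exp (Complex.I * t) * v 0 ∧ coeff t v = c := by
  have cancel : ∀ (v : ℝ → ℂ) (n : ℤ),
      (∀ x ∈ Icc (0 : ℝ) 1, v x = v 0 + ∫ s in (0 : ℝ)..x, w s) →
      v 1 = Complex.exp (Complex.I * t) * v 0 → (2 * (Real.pi : ℂ) * n + t ≠ 0) →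
      coeff t v n = c n := fun v n hv hbc hn => by
    have := coeff_of_primitive hw hv hbc n
    rw [hc] at this
    exact (mul_left_cancel₀ (mul_ne_zero Complex.I_ne_zero hn) this).symm
  by_cases het : Complex.exp (Complex.I * t) = 1
  · obtain ⟨n₀, hn₀⟩ := (exp_I_mul_eq_one_iff t).1 het
    have h0 : ∫ s in (0 : ℝ)..1, w s = 0 := by
      have := hc n₀
      simpa [coeff, hn₀] using this
    set J : ℂ := ∫ x in (0 : ℝ)..1, ∫ s in (0 : ℝ)..x, w s with hJ
    set v : ℝ → ℂ := fun x => (c n₀ - J) + ∫ s in (0 : ℝ)..x, w s with hvdef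
    have hv : ∀ x ∈ Icc (0 : ℝ) 1, v x = v 0 + ∫ s in (0 : ℝ)..x, w s := fun x _ => by
      simp [hvdef]
    have hbc : v 1 = Complex.exp (Complex.I * t) * v 0 := by simp [hvdef, het, h0]
    refine ⟨v, hv, hbc, funext fun n => ?_⟩
    by_cases hn : 2 * (Real.pi : ℂ) * n + t = 0
    · have hnn : n = n₀ := by
        have : 2 * (Real.pi : ℂ) * n = 2 * (Real.pi : ℂ) * n₀ := by
          linear_combination hn - hn₀
        exact_mod_cast mul_left_cancel₀ (by simp [Real.pi_ne_zero]) this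
      subst hnn
      have hi : IntervalIntegrable (fun x => ∫ s in (0 : ℝ)..x, w s) volume 0 1 :=
        (absolutelyContinuousOnInterval_integral hw).continuousOn.intervalIntegrable
      simp only [coeff, hn, mul_zero, zero_mul, neg_zero, Complex.exp_zero, one_mul, hvdef]
      rw [intervalIntegral.integral_add intervalIntegrable_const hi, ← hJ]
      simp
    · exact cancel v n hv hbc hn
  · have hne : Complex.exp (Complex.I * t) - 1 ≠ 0 := sub_ne_zero.2 het
    set v : ℝ → ℂ := fun x => (∫ s in (0 : ℝ)..1, w s) / (Complex.exp (Complex.I * t) - 1) +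
      ∫ s in (0 : ℝ)..x, w s with hvdef
    have hv : ∀ x ∈ Icc (0 : ℝ) 1, v x = v 0 + ∫ s in (0 : ℝ)..x, w s := fun x _ => by
      simp [hvdef]
    have hbc : v 1 = Complex.exp (Complex.I * t) * v 0 := by
      simp only [hvdef, intervalIntegral.integral_same]
      field_simp; ring
    exact ⟨v, hv, hbc, funext fun n => cancel v n hv hbc fun h =>
      het ((exp_I_mul_eq_one_iff t).2 ⟨n, h⟩)⟩

/-! ### Coefficients of elements of `L₂[0,1]` -/

theorem coeff_congr {t : ℂ} {f g : ℝ → ℂ} (h : f =ᵐ[volume.restrict (Icc (0 : ℝ) 1)] g) :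
    coeff t f = coeff t g := by
  funext n
  refine intervalIntegral.integral_congr_ae ?_
  filter_upwards [(ae_restrict_iff' measurableSet_Icc).1 h] with x hx hm
  rw [uIoc_of_le zero_le_one] at hm
  rw [hx (Ioc_subset_Icc_self hm)]

theorem intervalIntegrable_exp_mul {f : ℝ → ℂ} (hf : IntervalIntegrable f volume 0 1) (c : ℂ) :
    IntervalIntegrable (fun x : ℝ => Complex.exp (-(c * x)) * f x) volume 0 1 :=
  hf.continuousOn_mul (by fun_prop)

theorem coeff_add (t : ℂ) {f g : ℝ → ℂ} (hf : IntervalIntegrable f volume 0 1)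
    (hg : IntervalIntegrable g volume 0 1) : coeff t (f + g) = coeff t f + coeff t g := by
  funext n
  simp only [coeff, Pi.add_apply, mul_add]
  exact intervalIntegral.integral_add (intervalIntegrable_exp_mul hf _)
    (intervalIntegrable_exp_mul hg _)

theorem coeff_sub (t : ℂ) {f g : ℝ → ℂ} (hf : IntervalIntegrable f volume 0 1)
    (hg : IntervalIntegrable g volume 0 1) (n : ℤ) :
    coeff t (fun x => f x - g x) n = coeff t f n - coeff t g n := by
  simp only [coeff, mul_sub]
  exact intervalIntegral.integral_sub (intervalIntegrable_exp_mul hf _)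
    (intervalIntegrable_exp_mul hg _)

theorem coeff_smul (t c : ℂ) (f : ℝ → ℂ) : coeff t (c • f) = c • coeff t f := by
  funext n
  simp only [coeff, Pi.smul_apply, smul_eq_mul, ← intervalIntegral.integral_const_mul]
  congr 1; ext x; ring

theorem intervalIntegrable_coe (f : L2I) : IntervalIntegrable f volume 0 1 := by
  have h : Integrable f (volume.restrict (Icc (0 : ℝ) 1)) :=
    (Lp.memLp f).integrable (by norm_num)
  rw [intervalIntegrable_iff, uIoc_of_le zero_le_one]
  exact IntegrableOn.mono_set h Ioc_subset_Icc_self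

/-- The coefficients of elements of `L₂[0,1]`, as a linear map. -/
noncomputable def coeffLin (t : ℂ) : L2I →ₗ[ℂ] (ℤ → ℂ) where
  toFun f := coeff t f
  map_add' f g := by
    rw [coeff_congr (Lp.coeFn_add f g)]
    exact coeff_add t (intervalIntegrable_coe f) (intervalIntegrable_coe g)
  map_smul' c f := by
    rw [coeff_congr (Lp.coeFn_smul c f), coeff_smul]; rfl

theorem exists_norm_coeff_le (t : ℂ) {f : ℝ → ℂ} (hf : IntervalIntegrable f volume 0 1) :
    ∃ C, ∀ n, ‖coeff t f n‖ ≤ C := by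
  refine ⟨∫ x in (0 : ℝ)..1, Real.exp ‖t‖ * ‖f x‖, fun n => ?_⟩
  refine intervalIntegral.norm_integral_le_of_norm_le zero_le_one ?_ (hf.norm.const_mul _)
  filter_upwards with x hx
  rw [norm_mul, Complex.norm_exp]
  gcongr
  have : (-(Complex.I * (2 * Real.pi * n + t) * x)).re = t.im * x := by simp
  rw [this]
  calc t.im * x ≤ ‖t‖ * 1 := by
        refine mul_le_mul ((le_abs_self _).trans (Complex.abs_im_le_norm t)) hx.2 hx.1.le
          (norm_nonneg _)
    _ = ‖t‖ := mul_one _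

/-! ### Growth of the diagonal -/

/-- The symbol of `-y'' - z y` grows quadratically; the sign `σ` allows for either orientation of
the index set. -/
theorem eventually_sq_le_norm_symbol (σ : ℤˣ) (t z : ℂ) :
    ∀ᶠ n : ℤ in cofinite, (n : ℝ) ^ 2 ≤ ‖(2 * (Real.pi : ℂ) * ((σ * n : ℤ) : ℂ) + t) ^ 2 - z‖ := by
  obtain ⟨K, hK⟩ := exists_nat_gt (‖t‖ + ‖z‖ + 1)
  have hfin : (Icc (-(K : ℤ)) K).Finite := finite_Icc _ _
  filter_upwards [hfin.compl_mem_cofinite] with n hn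
  have hn' : (K : ℝ) ≤ |(n : ℝ)| := by
    have : (K : ℤ) ≤ |n| := by
      by_contra h
      exact hn ⟨(abs_le.1 (not_le.1 h).le).1, (abs_le.1 (not_le.1 h).le).2⟩
    exact_mod_cast this
  have hσ : ‖2 * (Real.pi : ℂ) * ((σ * n : ℤ) : ℂ)‖ = 2 * Real.pi * |(n : ℝ)| := by
    rcases Int.units_eq_one_or σ with rfl | rfl <;>
      simp [abs_of_pos Real.pi_pos]
  have h1 : 2 * Real.pi * |(n : ℝ)| - ‖t‖ ≤ ‖2 * (Real.pi : ℂ) * ((σ * n : ℤ) : ℂ) + t‖ := by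
    have := norm_sub_le (2 * (Real.pi : ℂ) * ((σ * n : ℤ) : ℂ) + t) t
    rw [add_sub_cancel_right, hσ] at this; linarith
  have h2 : 2 * |(n : ℝ)| ≤ ‖2 * (Real.pi : ℂ) * ((σ * n : ℤ) : ℂ) + t‖ := by
    nlinarith [Real.pi_gt_three, abs_nonneg (n : ℝ), norm_nonneg z, norm_nonneg t]
  have h3 := norm_sub_norm_le ((2 * (Real.pi : ℂ) * ((σ * n : ℤ) : ℂ) + t) ^ 2) z
  rw [norm_pow] at h3
  rw [← sq_abs (n : ℝ)]
  have h4 : 1 ≤ |(n : ℝ)| := by linarith [norm_nonneg z, norm_nonneg t]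
  nlinarith [norm_nonneg z, norm_nonneg t, abs_nonneg (n : ℝ)]

theorem summable_norm_symbol_inv (σ : ℤˣ) (t z : ℂ) :
    Summable fun n : ℤ => ‖(2 * (Real.pi : ℂ) * ((σ * n : ℤ) : ℂ) + t) ^ 2 - z‖⁻¹ := by
  refine Summable.of_norm_bounded_eventually (g := fun n : ℤ => 1 / (n : ℝ) ^ 2)
    (Real.summable_one_div_int_pow.2 one_lt_two) ?_
  filter_upwards [eventually_sq_le_norm_symbol σ t z,
    (finite_singleton (0 : ℤ)).compl_mem_cofinite] with n hn h0
  rw [norm_inv, norm_norm, one_div]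
  have : (n : ℝ) ≠ 0 := by exact_mod_cast h0
  exact inv_anti₀ (by positivity) hn

theorem summable_of_symbol_mul_bounded {t : ℂ} {a : ℤ → ℂ} {C : ℝ}
    (h : ∀ n : ℤ, ‖(2 * (Real.pi : ℂ) * n + t) ^ 2 * a n‖ ≤ C) : Summable a := by
  refine Summable.of_norm_bounded_eventually (g := fun n : ℤ => C * (1 / (n : ℝ) ^ 2))
    ((Real.summable_one_div_int_pow.2 one_lt_two).mul_left C) ?_
  filter_upwards [eventually_sq_le_norm_symbol 1 t 0,
    (finite_singleton (0 : ℤ)).compl_mem_cofinite] with n hn h0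
  simp only [Units.val_one, one_mul, sub_zero] at hn
  have h1 : (n : ℝ) ≠ 0 := by exact_mod_cast h0
  have h2 : 0 < (n : ℝ) ^ 2 := by positivity
  rw [mul_one_div, le_div_iff₀ h2, mul_comm]
  refine le_trans ?_ (h n)
  rw [norm_mul]
  gcongr

/-! ### The operator equation in terms of coefficients -/

/-- The coefficients of a function in the domain are summable and satisfy the matrix equation. -/
theorem summable_and_hasSum_of_mem_hillGraph {q : ℝ → ℂ} (hq : IntervalIntegrable q volume 0 1)
    {t : ℂ} {f g : L2I} (h : (f, g) ∈ hillGraph q t) :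
    Summable (coeffLin t f) ∧ ∀ n : ℤ, HasSum (fun m => coeffLin t f m * coeff 0 q (n - m))
      (coeffLin t g n - (2 * Real.pi * n + t) ^ 2 * coeffLin t f n) := by
  obtain ⟨y, y', hf, hs⟩ := h
  simp only at hf hs
  have hfy : coeffLin t f = coeff t y := coeff_congr hf
  have hyc : ContinuousOn y (Icc 0 1) := fun x hx => (hs.hasDeriv x hx).continuousWithinAt
  have hy'c : ContinuousOn y' (Icc 0 1) :=
    (continuousOn_primitive hs.integrable (y' 0)).congr hs.deriv_eq
  have hu : uIcc (0 : ℝ) 1 = Icc 0 1 := uIcc_of_le zero_le_one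
  have hy'i : IntervalIntegrable y' volume 0 1 := (hu.symm ▸ hy'c).intervalIntegrable
  have hyp : ∀ x ∈ Icc (0 : ℝ) 1, y x = y 0 + ∫ s in (0 : ℝ)..x, y' s := fun x hx => by
    have hsub : Icc (0 : ℝ) x ⊆ Icc 0 1 := Icc_subset_Icc_right hx.2
    rw [intervalIntegral.integral_eq_sub_of_hasDerivAt_of_le hx.1 (hyc.mono hsub)
      (fun s hs' => (hs.hasDeriv s (hsub (Ioo_subset_Icc_self hs'))).hasDerivAt
        (Icc_mem_nhds hs'.1 (hs'.2.trans_le hx.2)))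
      (hy'i.mono_set (by rw [hu, uIcc_of_le hx.1]; exact hsub))]
    ring
  have hqy : IntervalIntegrable (fun x => q x * y x) volume 0 1 :=
    hq.mul_continuousOn (hu.symm ▸ hyc)
  have hw : ∀ n : ℤ, coeff t (fun s => q s * y s) n - coeffLin t g n =
      -((2 * Real.pi * n + t) ^ 2 * coeff t y n) := fun n => by
    have h1 := coeff_of_primitive hs.integrable hs.deriv_eq hs.bc' n
    rw [coeff_of_primitive hy'i hyp hs.bc n, coeff_sub t hqy (intervalIntegrable_coe g)] at h1
    change coeff t (fun s => q s * y s) n - coeff t g n = _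
    rw [h1]
    linear_combination (2 * Real.pi * n + t) ^ 2 * coeff t y n * Complex.I_sq
  have hsum : Summable (coeff t y) := by
    obtain ⟨C, hC⟩ := exists_norm_coeff_le t hs.integrable
    refine summable_of_symbol_mul_bounded (t := t) (C := C) fun n => ?_
    rw [← norm_neg, ← hw n]
    refine le_trans (le_of_eq ?_) (hC n)
    rw [coeff_sub t hqy (intervalIntegrable_coe g)]; rfl
  rw [hfy]
  refine ⟨hsum, fun n => ?_⟩
  have hy := eqOn_synth_coeff hyc hs.bc hsum
  have hcon := hasSum_coeff_mul_synth hq t hsum n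
  have e : coeff t (fun x => q x * synth t (coeff t y) x) n = coeff t (fun x => q x * y x) n := by
    refine intervalIntegral.integral_congr fun x hx => ?_
    simp only
    rw [hy (hu ▸ hx)]
  rw [e] at hcon
  convert hcon using 1
  linear_combination -hw n

theorem memLp_synth (t : ℂ) {a : ℤ → ℂ} (ha : Summable a) :
    MemLp (synth t a) 2 (volume.restrict (Icc (0 : ℝ) 1)) := by
  obtain ⟨C, hC⟩ := isCompact_Icc.exists_bound_of_continuousOn
    (continuous_synth t ha).continuousOn (s := Icc (0 : ℝ) 1)
  refine MemLp.of_bound (continuous_synth t ha).aestronglyMeasurable C ?_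
  filter_upwards [ae_restrict_mem measurableSet_Icc] with x hx using hC x hx

/-- Conversely, a summable solution of the coefficient equations comes from the operator. -/
theorem exists_mem_hillGraph {q : ℝ → ℂ} (hq : IntervalIntegrable q volume 0 1) {t : ℂ}
    {a b : ℤ → ℂ} (ha : Summable a) (hb : Summable b)
    (h : ∀ n : ℤ, HasSum (fun m => a m * coeff 0 q (n - m))
      (b n - (2 * Real.pi * n + t) ^ 2 * a n)) :
    ∃ f g : L2I, (f, g) ∈ hillGraph q t ∧ coeffLin t f = a ∧ coeffLin t g = b := by
  have hca : ∀ {c : ℤ → ℂ} (hc : Summable c), coeffLin t (memLp_synth t hc).toLp = c :=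
    fun hc => (coeff_congr (memLp_synth t hc).coeFn_toLp).trans (funext (coeff_synth t hc))
  have hu : uIcc (0 : ℝ) 1 = Icc 0 1 := uIcc_of_le zero_le_one
  have hqy : IntervalIntegrable (fun x => q x * synth t a x) volume 0 1 :=
    hq.mul_continuousOn (continuous_synth t ha).continuousOn
  have hgi : IntervalIntegrable (synth t b) volume 0 1 :=
    (continuous_synth t hb).intervalIntegrable _ _
  have hwi := hqy.sub hgi
  obtain ⟨v₁, hv₁, hbc₁, hc₁⟩ := exists_primitive (t := t) hwi
    (c := fun n => Complex.I * (2 * Real.pi * n + t) * a n) (fun n => by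
      rw [coeff_sub t hqy hgi, coeff_synth t hb,
        (hasSum_coeff_mul_synth hq t ha n).unique (h n)]
      linear_combination -(2 * Real.pi * n + t) ^ 2 * a n * Complex.I_sq)
  have hv₁c : ContinuousOn v₁ (Icc 0 1) := (continuousOn_primitive hwi (v₁ 0)).congr hv₁
  have hv₁i : IntervalIntegrable v₁ volume 0 1 := (hu.symm ▸ hv₁c).intervalIntegrable
  obtain ⟨v₂, hv₂, hbc₂, hc₂⟩ := exists_primitive (t := t) hv₁i (c := a) (fun n => by rw [hc₁])
  have hv₂c : ContinuousOn v₂ (Icc 0 1) := (continuousOn_primitive hv₁i (v₂ 0)).congr hv₂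
  have he : EqOn v₂ (synth t a) (Icc 0 1) := by
    have := eqOn_synth_coeff hv₂c hbc₂ (by rwa [hc₂])
    rwa [hc₂] at this
  refine ⟨(memLp_synth t ha).toLp, (memLp_synth t hb).toLp,
    ⟨synth t a, v₁, (memLp_synth t ha).coeFn_toLp,
      IsHillSolution.congr (g := synth t b) ?_ (memLp_synth t hb).coeFn_toLp.symm⟩, hca ha, hca hb⟩
  refine ⟨fun x hx => ?_, hwi, hv₁, synth_one t a, hbc₁⟩
  have : Fact (x ∈ Icc (0 : ℝ) 1) := ⟨hx⟩
  have hd := intervalIntegral.integral_hasDerivWithinAt_right (s := Icc (0 : ℝ) 1)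
    (t := Icc (0 : ℝ) 1) (a := 0) (b := x) (f := v₁)
    (hv₁i.mono_set (by rw [hu, uIcc_of_le hx.1]; exact Icc_subset_Icc_right hx.2))
    (hv₁c.stronglyMeasurableAtFilter_nhdsWithin measurableSet_Icc x) (hv₁c x hx)
  exact (hd.const_add (v₂ 0)).congr (fun s hs => (he hs).symm.trans (hv₂ s hs))
    ((he hx).symm.trans (hv₂ x hx))

/-! ### Triangular systems with a dominant diagonal -/

/-- `a` is summable and `b = (D + T) a`, where `D` is the diagonal matrix with entries `d n` and `T`
the Toeplitz matrix with entries `Q (n - m)`. -/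
structure IsToeplitzSolution (Q d a b : ℤ → ℂ) : Prop where
  summable : Summable a
  hasSum : ∀ n, HasSum (fun m => a m * Q (n - m)) (b n - d n * a n)

/-- `a` is a summable sequence with `(D + T)^k a = 0`, all intermediate sequences being summable
too. -/
def IsRootSequence (Q d : ℤ → ℂ) : ℕ → (ℤ → ℂ) → Prop
  | 0, a => a = 0
  | k + 1, a => ∃ b, IsToeplitzSolution Q d a b ∧ IsRootSequence Q d k b

theorem IsRootSequence.summable {Q d : ℤ → ℂ} :
    ∀ {k : ℕ} {a : ℤ → ℂ}, IsRootSequence Q d k a → Summable a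
  | 0, a, h => by rw [show a = 0 from h]; exact summable_zero
  | _ + 1, _, ⟨_, h, _⟩ => h.summable

/-- Below the first nonzero entry of `a`, strict triangularity makes the convolution vanish. -/
theorem hasSum_conv_zero {Q a : ℤ → ℂ} (hQ : ∀ k ≤ 0, Q k = 0) {n : ℤ} (ha : ∀ m < n, a m = 0) :
    HasSum (fun m => a m * Q (n - m)) 0 := by
  convert hasSum_zero (α := ℂ) (β := ℤ) using 2 with m
  rcases lt_or_ge m n with h | h
  · rw [ha m h, zero_mul]
  · rw [hQ _ (by omega), mul_zero]

/-- Near `-∞` the diagonal dominates: on `{n ≤ M}` with `M` very negative, `D⁻¹ T` is a contraction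
of `ℓ¹`, and this block of the lower triangular system involves no other unknowns. -/
theorem IsToeplitzSolution.exists_forall_le_eq_zero {Q d a b : ℤ → ℂ} (hQ : ∀ k ≤ 0, Q k = 0)
    {C : ℝ} (hC : ∀ k, ‖Q k‖ ≤ C) (hd : Summable fun n => ‖d n‖⁻¹)
    (h : IsToeplitzSolution Q d a b) {M₀ : ℤ} (hb : ∀ n ≤ M₀, b n = 0) (hd0 : ∀ n ≤ M₀, d n ≠ 0) :
    ∃ M, ∀ n ≤ M, a n = 0 := by
  have hC0 : 0 ≤ C := (norm_nonneg _).trans (hC 0)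
  set ε : ℤ → ℝ := fun n => C * ‖d n‖⁻¹ with hε
  have hε0 : ∀ n, 0 ≤ ε n := fun n => by positivity
  obtain ⟨s, hs⟩ := summable_iff_vanishing_norm.1 (hd.mul_left C) (1 / 2) (by norm_num)
  obtain ⟨M₁, hM₁⟩ := s.bddBelow
  set M : ℤ := min M₀ (M₁ - 1) with hM
  set α : ℤ → ℝ := (Iic M).indicator fun n => ‖a n‖ with hα
  have hαs : Summable α := h.summable.norm.indicator _
  have hα0 : ∀ n, 0 ≤ α n := fun n => indicator_nonneg (fun _ _ => norm_nonneg _) n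
  set β : ℤ → ℝ := (Iic M).indicator ε with hβ
  have hβs : Summable β := (hd.mul_left C).indicator _
  have hβ1 : ∑' n, β n ≤ 1 / 2 := by
    refine hβs.tsum_le_of_sum_le fun u => ?_
    rw [hβ, Finset.sum_indicator_eq_sum_filter]
    have hdis : Disjoint (u.filter fun n => n ∈ Iic M) s := by
      refine Finset.disjoint_left.2 fun n hn hns => ?_
      have h1 : n ≤ M := (Finset.mem_filter.1 hn).2
      have h2 : M₁ ≤ n := hM₁ hns
      omega
    exact (le_abs_self _).trans (hs _ hdis).le
  -- for `n ≤ M` the equation reads `d n * a n = -∑ a m * Q (n - m)`, with only `m < n` contributing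
  have key : ∀ n, α n ≤ β n * ∑' m, α m := fun n => by
    by_cases hn : n ≤ M
    · have hnM : n ≤ M₀ := hn.trans (min_le_left _ _)
      have hterm : ∀ m, ‖a m * Q (n - m)‖ ≤ α m * C := fun m => by
        by_cases hm : m ≤ M
        · rw [norm_mul, hα, indicator_of_mem (by exact hm)]
          gcongr
          exact hC _
        · rw [hQ _ (by omega), mul_zero, norm_zero]
          exact mul_nonneg (hα0 m) hC0
      have hle := tsum_of_norm_bounded (hαs.hasSum.mul_right C) hterm
      rw [(h.hasSum n).tsum_eq, hb n hnM, zero_sub, norm_neg, norm_mul] at hle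
      have hdn : 0 < ‖d n‖ := norm_pos_iff.2 (hd0 n hnM)
      rw [hα, hβ, indicator_of_mem (by exact hn), indicator_of_mem (by exact hn), hε, ← hα]
      simp only
      rw [mul_right_comm, ← div_eq_mul_inv, le_div_iff₀ hdn]
      linarith
    · rw [hα, hβ, indicator_of_notMem (by exact hn), indicator_of_notMem (by exact hn), zero_mul]
  have hA : ∑' m, α m ≤ (∑' n, β n) * ∑' m, α m := by
    rw [← tsum_mul_right]
    exact hαs.tsum_le_tsum key (hβs.mul_right _)
  have hA0 : ∑' m, α m = 0 := by
    have : 0 ≤ ∑' m, α m := tsum_nonneg hα0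
    nlinarith
  refine ⟨M, fun n hn => ?_⟩
  have := (hαs.hasSum_iff.2 hA0)
  have h0 := (hasSum_zero_iff_of_nonneg hα0).1 this
  have h1 := congrFun h0 n
  rw [hα, indicator_of_mem (by exact hn)] at h1
  simpa using h1

/-- A root sequence is determined by its entries at the zeros of the diagonal: if those up to `N`
vanish, then all entries up to `N` do. -/
theorem IsRootSequence.eq_zero_of_le {Q d : ℤ → ℂ} (hQ : ∀ k ≤ 0, Q k = 0)
    {C : ℝ} (hC : ∀ k, ‖Q k‖ ≤ C) (hd : Summable fun n => ‖d n‖⁻¹) (hfin : {n | d n = 0}.Finite) :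
    ∀ (k : ℕ) (a : ℤ → ℂ), IsRootSequence Q d k a → ∀ N, (∀ n ≤ N, d n = 0 → a n = 0) →
      ∀ n ≤ N, a n = 0
  | 0, _, h, _, _, n, _ => congrFun h n
  | k + 1, a, ⟨b, h, hb⟩, N, hN, n, hn => by
    have IH := IsRootSequence.eq_zero_of_le hQ hC hd hfin k b hb
    obtain ⟨M₁, hM₁⟩ := hfin.bddBelow
    have hd0 : ∀ n ≤ M₁ - 1, d n ≠ 0 := fun n hn h0 => by
      have : M₁ ≤ n := hM₁ h0
      omega
    obtain ⟨M, hM⟩ := h.exists_forall_le_eq_zero hQ hC hd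
      (IH (M₁ - 1) fun n hn h0 => absurd h0 (hd0 n hn)) hd0
    -- as long as `a` vanishes below `n`, the equation at `n` reduces to `b n = d n * a n`
    have step : ∀ j : ℕ, M + j ≤ N → ∀ n ≤ M + j, a n = 0 := by
      intro j
      induction j with
      | zero => intro _ n hn; exact hM n (by simpa using hn)
      | succ j ih =>
        intro hj n hn
        push_cast at hj hn
        have ih' := ih (by omega)
        rcases hn.lt_or_eq with hlt | heq
        · exact ih' n (by omega)
        by_cases h0 : d n = 0
        · exact hN n (by omega) h0
        have hbd : ∀ n' ≤ n, b n' = d n' * a n' := fun n' hn' => by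
          have := (h.hasSum n').unique (hasSum_conv_zero hQ fun m hm => ih' m (by omega))
          linear_combination this
        have hbn : b n = 0 := IH n (fun n' hn' h0' => by rw [hbd n' hn', h0', zero_mul]) n le_rfl
        have := hbd n le_rfl
        rw [hbn] at this
        exact (mul_eq_zero.1 this.symm).resolve_left h0
    rcases le_or_gt n M with h1 | h1
    · exact hM n h1
    · refine step (n - M).toNat ?_ n ?_ <;> omega

/-- The solution of the triangular recursion that starts at the index `N` with the value `c`,
indexed by the distance from `N`. Division by zero makes it vanish at the later zeros of `d`. -/
noncomputable def triangularRec (Q d b : ℤ → ℂ) (N : ℤ) (c : ℂ) : ℕ → ℂ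
  | 0 => c
  | k + 1 => (b (N + (k + 1 : ℕ)) -
      ∑ j : Fin (k + 1), triangularRec Q d b N c j * Q ((k + 1 : ℕ) - (j : ℕ))) / d (N + (k + 1 : ℕ))
  decreasing_by exact j.2

/-- A discrete Grönwall inequality. -/
theorem summable_of_norm_succ_le {u : ℕ → ℂ} {ε : ℕ → ℝ} (hε : Summable ε) (hε0 : ∀ k, 0 ≤ ε k)
    (h : ∀ k, ‖u (k + 1)‖ ≤ ε k * (1 + ∑ j ∈ Finset.range (k + 1), ‖u j‖)) : Summable u := by
  have hs : ∀ k, 1 + ∑ j ∈ Finset.range (k + 1), ‖u j‖ ≤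
      (1 + ‖u 0‖) * Real.exp (∑ j ∈ Finset.range k, ε j) := by
    intro k
    induction k with
    | zero => simp
    | succ k ih =>
      have h0 : 0 ≤ 1 + ∑ j ∈ Finset.range (k + 1), ‖u j‖ := by positivity
      rw [Finset.sum_range_succ, Finset.sum_range_succ ε k, Real.exp_add]
      calc 1 + (∑ j ∈ Finset.range (k + 1), ‖u j‖ + ‖u (k + 1)‖)
          ≤ (1 + ∑ j ∈ Finset.range (k + 1), ‖u j‖) * (ε k + 1) := by linarith [h k]
        _ ≤ ((1 + ‖u 0‖) * Real.exp (∑ j ∈ Finset.range k, ε j)) * Real.exp (ε k) := by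
            gcongr
            · linarith [hε0 k]
            · exact Real.add_one_le_exp _
        _ = _ := by ring
  refine Summable.of_norm (summable_of_sum_range_le (c := (1 + ‖u 0‖) * Real.exp (∑' j, ε j))
    (fun _ => norm_nonneg _) fun k => ?_)
  calc ∑ j ∈ Finset.range k, ‖u j‖ ≤ 1 + ∑ j ∈ Finset.range (k + 1), ‖u j‖ := by
        rw [Finset.sum_range_succ]; linarith [norm_nonneg (u k)]
    _ ≤ _ := hs k
    _ ≤ _ := by
        gcongr
        exact hε.sum_le_tsum _ fun j _ => hε0 j

/-- Summable solutions of the triangular system started at an arbitrary index `N`; the equations at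
`N` itself and at the later zeros of the diagonal are not imposed. -/
theorem exists_triangular_solution {Q d b : ℤ → ℂ} (hQ : ∀ k ≤ 0, Q k = 0)
    {C : ℝ} (hC : ∀ k, ‖Q k‖ ≤ C) (hd : Summable fun n => ‖d n‖⁻¹) {B : ℝ} (hB : ∀ n, ‖b n‖ ≤ B)
    (N : ℤ) (c : ℂ) :
    ∃ u : ℤ → ℂ, Summable u ∧ (∀ n < N, u n = 0) ∧ u N = c ∧ (∀ n > N, d n = 0 → u n = 0) ∧
      ∀ n > N, d n ≠ 0 → HasSum (fun m => u m * Q (n - m)) (b n - d n * u n) := by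
  set w := triangularRec Q d b N c with hw
  have hws : ∀ k : ℕ, w (k + 1) = (b (N + (k + 1 : ℕ)) -
      ∑ j ∈ Finset.range (k + 1), w j * Q ((k + 1 : ℕ) - (j : ℕ))) / d (N + (k + 1 : ℕ)) :=
    fun k => by
      rw [hw, triangularRec, ← Finset.sum_range fun j : ℕ =>
        triangularRec Q d b N c j * Q ((k + 1 : ℕ) - (j : ℕ))]
  have hinj : Function.Injective fun k : ℕ => N + (k : ℤ) := fun i j h => by
    simpa using h
  have hC0 : 0 ≤ C := (norm_nonneg _).trans (hC 0)
  have hB0 : 0 ≤ B := (norm_nonneg _).trans (hB 0)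
  have hwsum : Summable w := by
    refine summable_of_norm_succ_le (ε := fun k : ℕ => ‖d (N + (k + 1 : ℕ))‖⁻¹ * (B + C)) ?_
      (fun k => by positivity) fun k => ?_
    · refine Summable.mul_right _ ?_
      exact (summable_nat_add_iff 1).2 (hd.comp_injective hinj)
    · rw [hws, norm_div, div_eq_inv_mul, mul_assoc]
      gcongr
      calc _ ≤ ‖b (N + (k + 1 : ℕ))‖ +
            ‖∑ j ∈ Finset.range (k + 1), w j * Q ((k + 1 : ℕ) - (j : ℕ))‖ := norm_sub_le _ _
        _ ≤ B + ∑ j ∈ Finset.range (k + 1), ‖w j‖ * C := by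
            refine add_le_add (hB _) ((norm_sum_le _ _).trans (Finset.sum_le_sum fun j _ => ?_))
            rw [norm_mul]; gcongr; exact hC _
        _ ≤ _ := by
            rw [← Finset.sum_mul]
            have : 0 ≤ ∑ j ∈ Finset.range (k + 1), ‖w j‖ := by positivity
            nlinarith
  set u : ℤ → ℂ := fun n => if n < N then 0 else w (n - N).toNat with hu
  have hlt : ∀ n < N, u n = 0 := fun n hn => if_pos hn
  have huk : ∀ k : ℕ, u (N + k) = w k := fun k => by
    simp [hu]
  have huw : ∀ n > N, ∃ k : ℕ, n = N + (k + 1 : ℕ) := fun n hn =>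
    ⟨(n - N).toNat - 1, by omega⟩
  refine ⟨u, ?_, hlt, by simpa [hw, triangularRec] using huk 0, ?_, ?_⟩
  · refine (hinj.summable_iff fun n hn => hlt n ?_).1 (by simpa only [Function.comp_def, huk])
    by_contra h
    exact hn ⟨(n - N).toNat, by simp only; omega⟩
  · intro n hn h0
    obtain ⟨k, rfl⟩ := huw n hn
    rw [huk, hws, h0, div_zero]
  · intro n hn h0
    obtain ⟨k, rfl⟩ := huw n hn
    have e : b (N + (k + 1 : ℕ)) - d (N + (k + 1 : ℕ)) * u (N + (k + 1 : ℕ)) =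
        ∑ j ∈ Finset.range (k + 1), w j * Q ((k + 1 : ℕ) - (j : ℕ)) := by
      rw [huk, hws]; field_simp; ring
    rw [e]
    refine (hinj.hasSum_iff fun m hm => ?_).1 ?_
    · rw [hlt m, zero_mul]
      by_contra h
      exact hm ⟨(m - N).toNat, by simp only; omega⟩
    · have e2 : ((fun m => u m * Q (N + (k + 1 : ℕ) - m)) ∘ fun k : ℕ => N + (k : ℤ)) =
          fun j : ℕ => w j * Q ((k + 1 : ℕ) - (j : ℤ)) := by
        funext j; simp only [Function.comp_apply, huk]; congr 2; omega
      rw [e2]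
      refine hasSum_sum_of_ne_finset_zero fun j hj => ?_
      rw [Finset.mem_range] at hj
      rw [hQ _ (by omega), mul_zero]

/-- The eigensequence that starts at the last zero of the diagonal. -/
theorem exists_eigensequence {Q d : ℤ → ℂ} (hQ : ∀ k ≤ 0, Q k = 0)
    {C : ℝ} (hC : ∀ k, ‖Q k‖ ≤ C) (hd : Summable fun n => ‖d n‖⁻¹) {N : ℤ} (hN : d N = 0)
    (hlast : ∀ n > N, d n ≠ 0) :
    ∃ y, IsToeplitzSolution Q d y 0 ∧ (∀ n < N, y n = 0) ∧ y N = 1 := by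
  obtain ⟨y, hs, h0, h1, -, h2⟩ := exists_triangular_solution (b := 0) hQ hC hd (B := 0)
    (by simp) N 1
  refine ⟨y, ⟨hs, fun n => ?_⟩, h0, h1⟩
  rcases lt_trichotomy n N with h | rfl | h
  · rw [h0 n h, mul_zero]
    simpa using hasSum_conv_zero hQ fun m hm => h0 m (hm.trans h)
  · rw [hN, zero_mul]
    simpa using hasSum_conv_zero hQ h0
  · exact h2 n h (hlast n h)

/-- The root sequence that starts at the smaller of two zeros `N₁ < N₂` of the diagonal. The
recursion from `N₁` leaves a residual `s` at `N₂`; adding a solution started after `N₂` turns the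
residual sequence into `s • y`, with `y` the eigensequence that starts at `N₂`. -/
theorem exists_root_sequence {Q d : ℤ → ℂ} (hQ : ∀ k ≤ 0, Q k = 0)
    {C : ℝ} (hC : ∀ k, ‖Q k‖ ≤ C) (hd : Summable fun n => ‖d n‖⁻¹) {N₁ N₂ : ℤ} (hN : N₁ < N₂)
    (h₁ : d N₁ = 0) (h₂ : d N₂ = 0) (hother : ∀ n, n ≠ N₁ → n ≠ N₂ → d n ≠ 0) :
    ∃ u, IsRootSequence Q d 2 u ∧ u N₁ = 1 := by
  obtain ⟨y, hy, hy0, hy1⟩ := exists_eigensequence hQ hC hd h₂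
    fun n hn => hother n (by omega) (by omega)
  obtain ⟨u, hus, hu0, hu1, hu2, hu⟩ := exists_triangular_solution (b := 0) hQ hC hd (B := 0)
    (by simp) N₁ 1
  have huQ : Summable fun m => u m * Q (N₂ - m) :=
    Summable.of_norm_bounded (hus.norm.mul_right C) fun m => by
      rw [norm_mul]; gcongr; exact hC _
  set s : ℂ := ∑' m, u m * Q (N₂ - m) with hs
  have hyb : ∀ n, ‖(s • y) n‖ ≤ ‖s‖ * ∑' m, ‖y m‖ := fun n => by
    rw [Pi.smul_apply, norm_smul]
    gcongr
    exact hy.summable.norm.le_tsum n fun _ _ => norm_nonneg _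
  obtain ⟨v, hvs, hv0, hv1, -, hv⟩ := exists_triangular_solution hQ hC hd hyb N₂ 0
  refine ⟨u + v, ⟨s • y, ⟨hus.add hvs, fun n => ?_⟩, 0, ⟨hy.summable.const_smul s, fun n => ?_⟩,
    rfl⟩, by simp [hu1, hv0 N₁ hN]⟩
  · have hadd : ∀ {p r : ℂ}, HasSum (fun m => u m * Q (n - m)) p →
        HasSum (fun m => v m * Q (n - m)) r → p + r = (s • y) n - d n * (u + v) n →
        HasSum (fun m => (u + v) m * Q (n - m)) ((s • y) n - d n * (u + v) n) := by
      intro p r hp hr he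
      rw [← he]
      simpa only [Pi.add_apply, add_mul] using hp.add hr
    rcases lt_trichotomy n N₂ with hn | rfl | hn
    · have hz := hasSum_conv_zero hQ (a := v) (n := n) fun m hm => hv0 m (hm.trans hn)
      rcases lt_trichotomy n N₁ with hn' | rfl | hn'
      · refine hadd (hasSum_conv_zero hQ fun m hm => hu0 m (hm.trans hn')) hz ?_
        simp [hy0 n hn, hu0 n hn', hv0 n hn]
      · refine hadd (hasSum_conv_zero hQ hu0) hz ?_
        simp [hy0 n hn, h₁]
      · refine hadd (hu n hn' (hother n (by omega) (by omega))) hz ?_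
        simp [hy0 n hn, hv0 n hn]
    · refine hadd huQ.hasSum (hasSum_conv_zero hQ hv0) ?_
      simp [hy1, h₂, hs]
    · have hdn := hother n (by omega) (by omega)
      refine hadd (hu n (by omega) hdn) (hv n hn hdn) ?_
      simp only [Pi.zero_apply, Pi.add_apply]; ring
  · have := (hy.hasSum n).mul_left s
    simp only [Pi.zero_apply, zero_sub] at this
    simp only [Pi.smul_apply, smul_eq_mul, Pi.zero_apply, zero_sub]
    have e : -(d n * (s * y n)) = s * -(d n * y n) := by ring
    simpa only [mul_assoc, e] using this

/-- Fourier uniqueness in `L₂[0,1]`. -/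
theorem coeffLin_injective (t : ℂ) : Function.Injective (coeffLin t) := by
  rw [← LinearMap.ker_eq_bot, LinearMap.ker_eq_bot']
  intro f hf
  have hi : IntervalIntegrable (fun s => (0 : ℂ) - f s) volume 0 1 :=
    intervalIntegrable_const.sub (intervalIntegrable_coe f)
  obtain ⟨v, hv, hbc, hc⟩ := exists_primitive (t := t) hi (c := 0) (fun n => by
    rw [coeff_sub t intervalIntegrable_const (intervalIntegrable_coe f),
      show coeff t f n = 0 from congrFun hf n]
    simp [coeff])
  have hvc : ContinuousOn v (Icc 0 1) := (continuousOn_primitive hi (v 0)).congr hv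
  have h0 : ∀ x ∈ Icc (0 : ℝ) 1, v x = 0 := fun x hx => by
    rw [eqOn_synth_coeff hvc hbc (by rw [hc]; exact summable_zero) hx, hc]
    simp [synth]
  -- `∫₀ˣ f = 0` for all `x` says that `(0, f)` lies in the graph of `-y''`, which is single-valued
  refine hillGraph_snd_eq_zero 0 t (0, f) ⟨0, 0, Lp.coeFn_zero _ _ _,
    fun x _ => hasDerivWithinAt_const x _ (0 : ℂ), by simpa using hi, fun x hx => ?_,
    by simp, by simp⟩ rfl
  have := hv x hx
  rw [h0 x hx, h0 0 (by simp), zero_add] at this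
  simpa using this

/-! ### Root functions as sequences -/

theorem mem_domain_hillOperator_iff {q : ℝ → ℂ} {t : ℂ} {f : L2I} :
    f ∈ (hillOperator q t).domain ↔ ∃ g, (f, g) ∈ hillGraph q t := by
  rw [LinearPMap.mem_domain_iff, hillOperator_graph]

theorem mem_hillGraph_iff {q : ℝ → ℂ} {t : ℂ} {f g : L2I} (hf : f ∈ (hillOperator q t).domain) :
    (f, g) ∈ hillGraph q t ↔ hillOperator q t ⟨f, hf⟩ = g := by
  rw [← hillOperator_graph, LinearPMap.mem_graph_iff]
  constructor
  · rintro ⟨y, hy, rfl⟩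
    congr 1; exact Subtype.ext hy.symm
  · intro h
    exact ⟨⟨f, hf⟩, rfl, h⟩

section Coefficients

variable {q : ℝ → ℂ} {σ : ℤˣ} {t z : ℂ}

/-- The diagonal of `L_t(q) - z` in the basis `e^{i(2πσn+t)x}`. The sign `σ` is chosen so that the
matrix of multiplication by `q` is strictly lower triangular. -/
noncomputable def hillSymbol (σ : ℤˣ) (t z : ℂ) (n : ℤ) : ℂ :=
  (2 * (Real.pi : ℂ) * ((σ * n : ℤ) : ℂ) + t) ^ 2 - z

/-- The Toeplitz symbol of multiplication by `q` in the basis `e^{i(2πσn+t)x}`. -/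
noncomputable def potentialCoeff (q : ℝ → ℂ) (σ : ℤˣ) (n : ℤ) : ℂ := coeff 0 q (σ * n)

/-- The coefficients with respect to `e^{i(2πσn+t)x}`. -/
noncomputable def signedCoeff (σ : ℤˣ) (t : ℂ) : L2I →ₗ[ℂ] (ℤ → ℂ) :=
  LinearMap.funLeft ℂ ℂ (fun n : ℤ => (σ * n : ℤ)) ∘ₗ coeffLin t

theorem signedCoeff_apply (f : L2I) (n : ℤ) : signedCoeff σ t f n = coeffLin t f (σ * n) := rfl

theorem signedCoeff_injective (σ : ℤˣ) (t : ℂ) : Function.Injective (signedCoeff σ t) := by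
  have h : Function.Injective (LinearMap.funLeft ℂ ℂ fun n : ℤ => (σ * n : ℤ)) :=
    LinearMap.funLeft_injective_of_surjective ℂ ℂ _ σ.mulLeft.surjective
  exact h.comp (coeffLin_injective t)

theorem isToeplitzSolution_signedCoeff (hq : IntervalIntegrable q volume 0 1) {f g : L2I}
    (h : (f, g) ∈ hillGraph q t) :
    IsToeplitzSolution (potentialCoeff q σ) (hillSymbol σ t z) (signedCoeff σ t f)
      (signedCoeff σ t (g - z • f)) := by
  obtain ⟨hs, hsum⟩ := summable_and_hasSum_of_mem_hillGraph hq h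
  refine ⟨hs.comp_injective σ.mulLeft.injective, fun n => ?_⟩
  have := (Equiv.hasSum_iff σ.mulLeft).2 (hsum (σ * n))
  convert this using 1
  · funext m
    simp only [Function.comp_apply, signedCoeff_apply, potentialCoeff, Units.mulLeft_apply, mul_sub]
  · simp only [map_sub, map_smul, Pi.sub_apply, Pi.smul_apply, smul_eq_mul, signedCoeff_apply,
      hillSymbol]
    ring

theorem exists_mem_hillGraph_of_isToeplitzSolution (hq : IntervalIntegrable q volume 0 1)
    {a b : ℤ → ℂ} (h : IsToeplitzSolution (potentialCoeff q σ) (hillSymbol σ t z) a b)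
    (hb : Summable b) :
    ∃ f g : L2I, (f, g) ∈ hillGraph q t ∧ signedCoeff σ t f = a ∧
      signedCoeff σ t (g - z • f) = b := by
  have hσσ : ∀ n : ℤ, (σ : ℤ) * (σ * n) = n := fun n => by
    rw [← mul_assoc, ← Units.val_mul, Int.units_mul_self]; simp
  have hinj : Function.Injective fun n : ℤ => (σ * n : ℤ) := σ.mulLeft.injective
  obtain ⟨f, g, hfg, hf, hg⟩ := exists_mem_hillGraph hq (t := t) (a := fun n => a (σ * n))
    (b := fun n => b (σ * n) + z * a (σ * n)) (h.summable.comp_injective hinj)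
    ((hb.comp_injective hinj).add ((h.summable.comp_injective hinj).mul_left z)) (fun n => by
      have := (Equiv.hasSum_iff σ.mulLeft).2 (h.hasSum (σ * n))
      convert this using 1
      · funext m
        simp only [Function.comp_apply, potentialCoeff, Units.mulLeft_apply, mul_sub, hσσ]
      · simp only [hillSymbol, hσσ]; ring)
  have hfa : signedCoeff σ t f = a := by
    funext n; rw [signedCoeff_apply, hf]; simp only [hσσ]
  refine ⟨f, g, hfg, hfa, ?_⟩
  rw [map_sub, map_smul, hfa]
  funext n
  simp only [Pi.sub_apply, Pi.smul_apply, smul_eq_mul, signedCoeff_apply, hg, hσσ]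
  ring

theorem mem_rootSpace_iff (hq : IntervalIntegrable q volume 0 1) (k : ℕ) (f : L2I) :
    f ∈ rootSpace (hillOperator q t) z k ↔
      IsRootSequence (potentialCoeff q σ) (hillSymbol σ t z) k (signedCoeff σ t f) := by
  induction k generalizing f with
  | zero =>
    change f ∈ (⊥ : Submodule ℂ L2I) ↔ signedCoeff σ t f = 0
    rw [Submodule.mem_bot, map_eq_zero_iff _ (signedCoeff_injective σ t)]
  | succ k ih =>
    constructor
    · rintro ⟨hf, h⟩
      exact ⟨_, isToeplitzSolution_signedCoeff hq ((mem_hillGraph_iff hf).2 rfl), (ih _).1 h⟩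
    · rintro ⟨b, h, hb⟩
      obtain ⟨f', g, hfg, hf', hg⟩ :=
        exists_mem_hillGraph_of_isToeplitzSolution hq h hb.summable
      obtain rfl := signedCoeff_injective σ t hf'
      refine ⟨mem_domain_hillOperator_iff.2 ⟨g, hfg⟩, ?_⟩
      rw [(mem_hillGraph_iff _).1 hfg, ih, hg]
      exact hb

theorem exists_mem_rootSpace (hq : IntervalIntegrable q volume 0 1) {k : ℕ} {a : ℤ → ℂ}
    (h : IsRootSequence (potentialCoeff q σ) (hillSymbol σ t z) k a) :
    ∃ f ∈ rootSpace (hillOperator q t) z k, signedCoeff σ t f = a := by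
  cases k with
  | zero => exact ⟨0, Submodule.zero_mem _, by rw [map_zero]; exact h.symm⟩
  | succ k =>
    obtain ⟨b, hab, hb⟩ := id h
    obtain ⟨f, g, -, hf, -⟩ := exists_mem_hillGraph_of_isToeplitzSolution hq hab hb.summable
    exact ⟨f, (mem_rootSpace_iff hq _ f).2 (by rwa [hf]), hf⟩

end Coefficients

section Operator

variable {E : Type*} [AddCommGroup E] [Module ℂ E]

theorem isEigenvalue_iff_exists_mem_rootSpace (A : E →ₗ.[ℂ] E) (z : ℂ) :
    IsEigenvalue A z ↔ ∃ f ∈ rootSpace A z 1, f ≠ 0 := by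
  constructor
  · rintro ⟨f, hf, h⟩
    refine ⟨f, ⟨f.2, ?_⟩, hf⟩
    change A f - z • (f : E) ∈ (⊥ : Submodule ℂ E)
    rw [Submodule.mem_bot, sub_eq_zero]; exact h
  · rintro ⟨f, ⟨hf, h⟩, hf0⟩
    exact ⟨⟨f, hf⟩, hf0, sub_eq_zero.1 ((Submodule.mem_bot ℂ).1 h)⟩

theorem monotone_rootSpace (A : E →ₗ.[ℂ] E) (z : ℂ) : Monotone (rootSpace A z) := by
  refine monotone_nat_of_le_succ fun k => ?_
  induction k with
  | zero => exact bot_le (α := Submodule ℂ E)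
  | succ k ih =>
    rintro f ⟨hf, h⟩
    exact ⟨hf, ih h⟩

theorem mem_iSup_rootSpace {A : E →ₗ.[ℂ] E} {z : ℂ} {f : E} :
    f ∈ (⨆ k, rootSpace A z k : Submodule ℂ E) ↔ ∃ k, f ∈ rootSpace A z k :=
  Submodule.mem_iSup_of_directed _ (monotone_rootSpace A z).directed_le

end Operator

/-! ### Multiplicities for one-sided potentials -/

/-- `q` is integrable on the period and, along the orientation `σ` of the index set, has nonzero
Fourier coefficients at positive indices only. -/
structure IsOneSided (q : ℝ → ℂ) (σ : ℤˣ) : Prop where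
  intervalIntegrable : IntervalIntegrable q volume 0 1
  potentialCoeff_eq_zero : ∀ k ≤ 0, potentialCoeff q σ k = 0

section OneSided

variable {q : ℝ → ℂ} {σ : ℤˣ} {t z : ℂ}

theorem exists_norm_potentialCoeff_le (hq : IntervalIntegrable q volume 0 1) (σ : ℤˣ) :
    ∃ C, ∀ k, ‖potentialCoeff q σ k‖ ≤ C :=
  (exists_norm_coeff_le 0 hq).imp fun _ hC _ => hC _

theorem finite_hillSymbol_eq_zero (σ : ℤˣ) (t z : ℂ) : {n | hillSymbol σ t z n = 0}.Finite := by
  refine ((eventually_cofinite.1 (eventually_sq_le_norm_symbol σ t z)).union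
    (finite_singleton (0 : ℤ))).subset fun n hn => ?_
  by_contra h
  simp only [mem_union, mem_ofPred_eq, mem_singleton_iff, not_or, not_not] at h
  have h1 := h.1
  rw [show (2 * (Real.pi : ℂ) * ((σ * n : ℤ) : ℂ) + t) ^ 2 - z = 0 from hn, norm_zero] at h1
  have : (n : ℝ) ≠ 0 := by exact_mod_cast h.2
  exact absurd h1 (not_le.2 (by positivity))

theorem IsOneSided.eq_zero_of_signedCoeff (hq : IsOneSided q σ) {k : ℕ} {f : L2I}
    (hf : f ∈ rootSpace (hillOperator q t) z k)
    (h : ∀ n, hillSymbol σ t z n = 0 → signedCoeff σ t f n = 0) : f = 0 := by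
  obtain ⟨C, hC⟩ := exists_norm_potentialCoeff_le hq.intervalIntegrable σ
  refine (map_eq_zero_iff _ (signedCoeff_injective σ t)).1 (funext fun n => ?_)
  exact IsRootSequence.eq_zero_of_le hq.potentialCoeff_eq_zero hC
    (summable_norm_symbol_inv σ t z) (finite_hillSymbol_eq_zero σ t z) k _
    ((mem_rootSpace_iff hq.intervalIntegrable k f).1 hf) n (fun m _ => h m) n le_rfl

/-- The algebraic multiplicity is at most the number of zeros of the symbol. -/
theorem IsOneSided.algMultiplicity_le (hq : IsOneSided q σ) (S : Finset ℤ)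
    (hS : ∀ n, hillSymbol σ t z n = 0 → n ∈ S) :
    algMultiplicity (hillOperator q t) z ≤ (S.card : Cardinal) := by
  let φ : (⨆ k, rootSpace (hillOperator q t) z k : Submodule ℂ L2I) →ₗ[ℂ] (S → ℂ) :=
    LinearMap.funLeft ℂ ℂ (Subtype.val : S → ℤ) ∘ₗ signedCoeff σ t ∘ₗ Submodule.subtype _
  have hφ : Function.Injective φ := by
    rw [← LinearMap.ker_eq_bot, LinearMap.ker_eq_bot']
    rintro ⟨f, hf⟩ h
    obtain ⟨k, hk⟩ := mem_iSup_rootSpace.1 hf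
    exact Subtype.ext (hq.eq_zero_of_signedCoeff hk fun n hn => congrFun h ⟨n, hS n hn⟩)
  have := LinearMap.rank_le_of_injective φ hφ
  rwa [rank_fun', Fintype.card_coe] at this

theorem IsOneSided.exists_eigenvector (hq : IsOneSided q σ) {N : ℤ} (hN : hillSymbol σ t z N = 0)
    (hlast : ∀ n > N, hillSymbol σ t z n ≠ 0) :
    ∃ f ∈ rootSpace (hillOperator q t) z 1,
      (∀ n < N, signedCoeff σ t f n = 0) ∧ signedCoeff σ t f N = 1 := by
  obtain ⟨C, hC⟩ := exists_norm_potentialCoeff_le hq.intervalIntegrable σ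
  obtain ⟨y, hy, hy0, hy1⟩ := exists_eigensequence hq.potentialCoeff_eq_zero hC
    (summable_norm_symbol_inv σ t z) hN hlast
  obtain ⟨f, hf, rfl⟩ := exists_mem_rootSpace hq.intervalIntegrable (k := 1) ⟨0, hy, rfl⟩
  exact ⟨f, hf, hy0, hy1⟩

theorem ne_zero_of_signedCoeff_eq_one {f : L2I} {n : ℤ} (h : signedCoeff σ t f n = 1) : f ≠ 0 := by
  rintro rfl
  simp at h

theorem IsOneSided.isEigenvalue_iff (hq : IsOneSided q σ) :
    IsEigenvalue (hillOperator q t) z ↔ ∃ n, hillSymbol σ t z n = 0 := by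
  rw [isEigenvalue_iff_exists_mem_rootSpace]
  constructor
  · rintro ⟨f, hf, hf0⟩
    by_contra! h
    exact hf0 (hq.eq_zero_of_signedCoeff hf fun n hn => absurd hn (h n))
  · intro h
    obtain ⟨M, hM⟩ := (finite_hillSymbol_eq_zero σ t z).bddAbove
    obtain ⟨N, hN, hlast⟩ := Int.exists_greatest_of_bdd ⟨M, fun n hn => hM hn⟩ h
    obtain ⟨f, hf, -, hf1⟩ := hq.exists_eigenvector hN fun n hn h0 =>
      absurd (hlast n h0) (not_le.2 hn)
    exact ⟨f, hf, ne_zero_of_signedCoeff_eq_one hf1⟩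

theorem IsOneSided.isSimpleEigenvalue (hq : IsOneSided q σ) {N : ℤ}
    (hN : ∀ n, hillSymbol σ t z n = 0 ↔ n = N) : IsSimpleEigenvalue (hillOperator q t) z := by
  refine ⟨hq.isEigenvalue_iff.2 ⟨N, (hN N).2 rfl⟩, le_antisymm ?_ ?_⟩
  · simpa using hq.algMultiplicity_le {N} fun n hn => by simpa using (hN n).1 hn
  · obtain ⟨f, hf, -, hf1⟩ := hq.exists_eigenvector ((hN N).2 rfl) fun n hn h0 =>
      hn.ne' ((hN n).1 h0)
    rw [Cardinal.one_le_iff_pos]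
    refine rank_pos_iff_exists_ne_zero.2 ⟨⟨f, mem_iSup_rootSpace.2 ⟨1, hf⟩⟩, fun h => ?_⟩
    exact ne_zero_of_signedCoeff_eq_one hf1 (congrArg Subtype.val h)

theorem IsOneSided.isDoubleEigenvalue (hq : IsOneSided q σ) {N₁ N₂ : ℤ} (hne : N₁ ≠ N₂)
    (hN : ∀ n, hillSymbol σ t z n = 0 ↔ n = N₁ ∨ n = N₂) :
    IsDoubleEigenvalue (hillOperator q t) z := by
  wlog hlt : N₁ < N₂ generalizing N₁ N₂
  · exact this hne.symm (fun n => (hN n).trans or_comm) (lt_of_le_of_ne (not_lt.1 hlt) hne.symm)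
  refine ⟨hq.isEigenvalue_iff.2 ⟨N₁, (hN N₁).2 (Or.inl rfl)⟩, le_antisymm ?_ ?_⟩
  · have := hq.algMultiplicity_le (t := t) (z := z) {N₁, N₂} fun n hn => by simpa using (hN n).1 hn
    rwa [Finset.card_pair hne] at this
  · obtain ⟨f, hf, hf0, hf1⟩ := hq.exists_eigenvector ((hN N₂).2 (Or.inr rfl)) fun n hn h0 => by
      rcases (hN n).1 h0 with rfl | rfl <;> omega
    obtain ⟨C, hC⟩ := exists_norm_potentialCoeff_le hq.intervalIntegrable σ
    obtain ⟨u, hu, hu1⟩ := exists_root_sequence hq.potentialCoeff_eq_zero hC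
      (summable_norm_symbol_inv σ t z) hlt ((hN N₁).2 (Or.inl rfl)) ((hN N₂).2 (Or.inr rfl))
      fun n h1 h2 h0 => ((hN n).1 h0).elim h1 h2
    obtain ⟨g, hg, rfl⟩ := exists_mem_rootSpace hq.intervalIntegrable hu
    let R : Submodule ℂ L2I := ⨆ k, rootSpace (hillOperator q t) z k
    let f' : R := ⟨f, mem_iSup_rootSpace.2 ⟨1, hf⟩⟩
    let g' : R := ⟨g, mem_iSup_rootSpace.2 ⟨2, hg⟩⟩
    have hli : LinearIndependent ℂ ![f', g'] := by
      rw [LinearIndependent.pair_iff]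
      intro α β h
      have h' : α • f + β • g = 0 := congrArg Subtype.val h
      have hc : ∀ n, α * signedCoeff σ t f n + β * signedCoeff σ t g n = 0 := fun n => by
        simpa using congrFun (congrArg (signedCoeff σ t) h') n
      have hβ : β = 0 := by simpa [hf0 N₁ hlt, hu1] using hc N₁
      have hα : α = 0 := by simpa [hf1, hβ] using hc N₂
      exact ⟨hα, hβ⟩
    simpa [algMultiplicity] using hli.cardinal_le_rank

end OneSided

theorem hillSymbol_eq_zero_iff (σ : ℤˣ) (t : ℂ) (m n : ℤ) :
    hillSymbol σ t ((2 * (Real.pi : ℂ) * (m : ℂ) + t) ^ 2) n = 0 ↔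
      n = σ * m ∨ t = (Real.pi : ℂ) * ((-(σ * n + m) : ℤ) : ℂ) := by
  have hπ : (Real.pi : ℂ) ≠ 0 := by exact_mod_cast Real.pi_ne_zero
  have hσ : (σ * n : ℤ) = m ↔ n = σ * m := by
    rcases Int.units_eq_one_or σ with rfl | rfl <;> simp [neg_eq_iff_eq_neg]
  rw [hillSymbol, sub_eq_zero, sq_eq_sq_iff_eq_or_eq_neg, ← hσ]
  refine or_congr ?_ ?_
  · rw [add_left_inj, mul_right_inj' (by simp [hπ])]
    exact_mod_cast Iff.rfl
  · push_cast
    constructor <;> intro h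
    · linear_combination h / 2
    · linear_combination 2 * h

theorem theorem1 (q : ℝ → ℂ) (hper : Function.Periodic q 1)
    (hint : IntervalIntegrable q volume 0 1)
    (hq : (∀ n : ℤ, n ≤ 0 → fourierCoeffOn (zero_lt_one' ℝ) q n = 0) ∨
      (∀ n : ℤ, 0 ≤ n → fourierCoeffOn (zero_lt_one' ℝ) q n = 0)) :
    (∀ t z : ℂ, IsEigenvalue (hillOperator q t) z ↔
      ∃ n : ℤ, z = (2 * (Real.pi : ℂ) * (n : ℂ) + t) ^ 2) ∧
    (∀ t : ℂ, (∀ k : ℤ, t ≠ (Real.pi : ℂ) * (k : ℂ)) → ∀ n : ℤ,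
      IsSimpleEigenvalue (hillOperator q t) ((2 * (Real.pi : ℂ) * (n : ℂ) + t) ^ 2)) ∧
    (∀ n : ℤ, n ≠ 0 →
      IsDoubleEigenvalue (hillOperator q 0) ((2 * (Real.pi : ℂ) * (n : ℂ)) ^ 2)) ∧
    (∀ n : ℤ, IsDoubleEigenvalue (hillOperator q (Real.pi : ℂ))
      ((2 * (Real.pi : ℂ) * (n : ℂ) + (Real.pi : ℂ)) ^ 2)) := by
  have hπ : (Real.pi : ℂ) ≠ 0 := by exact_mod_cast Real.pi_ne_zero
  obtain ⟨σ, hσ⟩ : ∃ σ : ℤˣ, IsOneSided q σ := by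
    rcases hq with h | h
    · refine ⟨1, hint, fun k hk => ?_⟩
      rw [potentialCoeff, ← fourierCoeffOn_eq_coeff]
      exact h _ (by simpa using hk)
    · refine ⟨-1, hint, fun k hk => ?_⟩
      rw [potentialCoeff, ← fourierCoeffOn_eq_coeff]
      exact h _ (by simpa using hk)
  have hσm : ∀ m : ℤ, (σ : ℤ) * (σ * m) = m := fun m => by
    rw [← mul_assoc, ← Units.val_mul, Int.units_mul_self]; simp
  refine ⟨fun t z => ?_, fun t ht m => ?_, fun m hm => ?_, fun m => ?_⟩
  · rw [hσ.isEigenvalue_iff]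
    constructor
    · rintro ⟨n, hn⟩
      exact ⟨σ * n, (sub_eq_zero.1 hn).symm⟩
    · rintro ⟨m, rfl⟩
      exact ⟨σ * m, (hillSymbol_eq_zero_iff σ t m _).2 (Or.inl rfl)⟩
  · refine hσ.isSimpleEigenvalue (N := σ * m) fun n => ?_
    rw [hillSymbol_eq_zero_iff]
    exact or_iff_left (ht _)
  · refine hσ.isDoubleEigenvalue (N₁ := σ * m) (N₂ := σ * (-m)) ?_ fun n => ?_
    · intro h
      have := σ.mulLeft.injective h
      omega
    · have := hillSymbol_eq_zero_iff σ 0 m n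
      rw [add_zero] at this
      rw [this]
      refine or_congr Iff.rfl ?_
      rw [eq_comm, mul_eq_zero, or_iff_right hπ, Int.cast_eq_zero]
      constructor <;> intro h
      · rw [← hσm n]; congr 1; omega
      · rw [h, hσm]; omega
  · refine hσ.isDoubleEigenvalue (N₁ := σ * m) (N₂ := σ * (-m - 1)) ?_ fun n => ?_
    · intro h
      have := σ.mulLeft.injective h
      omega
    · rw [hillSymbol_eq_zero_iff]
      refine or_congr Iff.rfl ?_
      rw [eq_comm, mul_eq_left₀ hπ]
      have : (((-(σ * n + m) : ℤ) : ℂ) = 1) ↔ -(σ * n + m) = 1 := by exact_mod_cast Iff.rfl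
      rw [this]
      constructor <;> intro h
      · rw [← hσm n]; congr 1; omega
      · rw [h, hσm]; omega
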